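/- Let $K$ be a field and $P=K[x_1,\dots,x_n]$. For a term $x^\mu\neq 1$ let $m(x^\mu)$ be the maximal index $k$ with $\mu_k\neq 0$, and put $m(1)=1$. Let $J$ be a proper monomial ideal of $P$ with minimal basis $G=\{x^{\mu^{(1)}},\dots,x^{\mu^{(r)}}\}$, and write $\deg G$ for the maximal degree of an element of $G$ (with $\deg\emptyset=0$ if $J=0$). For an integer $\ell\ge 0$, the ideal $J$ is called $\ell$-quasi-stable if for every term $x^\mu\in J$ with $m=m(x^\mu)\ge n-\ell$ and every index $j<m$ the term $x_j^{q}\,x^\mu/x_m^{\mu_m}$ also lies in $J$, where $q$ is the maximal degree of a minimal generator of $J$ (for $J=0$ the condition is void). The algorithm DQS-Test takes only $G$ as input and proceeds as follows. 1. Let $\ell$ be the smallest integer $j\ge 0$ such that $x_\alpha^{\deg G}\in\langle G\rangle$ for $\alpha=1,\dots,n-j$. 2. For all $x^\mu\in G$ with $k=m(x^\mu)\ge n-\ell$ and for $i=1,\dots,k-1$: if $x_i^{\deg G}\,x^\mu/x_k^{\mu_k}\notin\langle G\rangle$, return false. 3. Return true. (Membership of a term in $\langle G\rangle$ is tested by searching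 for an element of $G$ that divides it.) Proposition. DQS-Test is correct: it returns true if and only if $J$ is $D$-quasi-stable, where $D=\dim(P/J)$ is the Krull dimension. -/

import Mathlib

/-- Exponent vectors `μ` of the terms `x^μ` in the variables `x_1, …, x_n`.  The variable `x_i` of the
text is the variable with index `i - 1` in `Fin n`; divisibility of terms is the pointwise order. -/
abbrev Expo (n : ℕ) : Type := Fin n → ℕ

namespace Expo

variable {n : ℕ}

/-- The total degree of `x^μ`. -/
def deg (μ : Expo n) : ℕ := ∑ i, μ i

/-- The maximal (one-based) index `k` with `μ_k ≠ 0`; it is `1` for the constant term. -/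
def maxIndex (μ : Expo n) : ℕ :=
  if μ = 0 then 1 else Finset.univ.sup fun i : Fin n => if μ i = 0 then 0 else i.val + 1

/-- The exponent vector of `x_j ^ q * x^μ / x_m ^ μ_m`, where `m = maxIndex μ`. -/
def move (q : ℕ) (j : Fin n) (μ : Expo n) : Expo n := fun i =>
  (if i.val + 1 = maxIndex μ then 0 else μ i) + (if i = j then q else 0)

/-- The term `x^μ = x_1 ^ μ_1 ⋯ x_n ^ μ_n` as a polynomial. -/
noncomputable def term (K : Type*) [CommSemiring K] (μ : Expo n) : MvPolynomial (Fin n) K :=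
  ∏ i, MvPolynomial.X i ^ μ i

theorem term_eq_monomial (K : Type*) [CommSemiring K] (μ : Expo n) :
    term K μ = MvPolynomial.monomial (Finsupp.equivFunOnFinite.symm μ) (1 : K) := by
  rw [MvPolynomial.monomial_eq, Finsupp.prod_fintype _ _ (by simp)]
  simp [term]

end Expo

section QuasiStability

variable {K : Type*} [Field K] {n : ℕ}

/-- The ideal generated by the terms with exponents in `S`. -/
noncomputable def termIdeal (K : Type*) [Field K] {n : ℕ} (S : Set (Expo n)) :
    Ideal (MvPolynomial (Fin n) K) :=
  Ideal.span (Expo.term K '' S)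

/-- `S` is the minimal basis of the monomial ideal `J`: the terms with exponents in `S` generate `J`,
and no proper subset of them does. -/
def IsMinimalBasis (S : Set (Expo n)) (J : Ideal (MvPolynomial (Fin n) K)) : Prop :=
  termIdeal K S = J ∧ ∀ T : Set (Expo n), T ⊂ S → termIdeal K T ≠ J

/-- The minimal generators of the monomial ideal `J`: the terms of `J` that are minimal with respect to
divisibility among all terms of `J`. -/
def minimalGenerators (J : Ideal (MvPolynomial (Fin n) K)) : Set (Expo n) :=
  {μ | Minimal (fun ν : Expo n => Expo.term K ν ∈ J) μ}

theorem minimalGenerators_finite (J : Ideal (MvPolynomial (Fin n) K)) :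
    (minimalGenerators J).Finite := by
  have h : IsAntichain (· ≤ ·) (minimalGenerators J) := by
    intro a ha b hb hne hab
    exact hne (le_antisymm hab (hb.2 ha.1 hab))
  exact WellQuasiOrderedLE.finite_of_isAntichain h

/-- The maximal degree `q` of a minimal generator of `J` (`0` for the zero ideal, which has none). -/
noncomputable def maxGenDegree (J : Ideal (MvPolynomial (Fin n) K)) : ℕ :=
  (minimalGenerators_finite J).toFinset.sup Expo.deg

/-- `ℓ`-quasi-stability of a monomial ideal `J`: for every term `x^μ ∈ J` with
`m = maxIndex μ ≥ n - ℓ` and every `j < m`, the term `x_j ^ q * x^μ / x_m ^ μ_m` lies in `J`, where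
`q` is the maximal degree of a minimal generator of `J`. -/
def IsQuasiStable (ℓ : ℕ) (J : Ideal (MvPolynomial (Fin n) K)) : Prop :=
  ∀ μ : Expo n, Expo.term K μ ∈ J → n ≤ μ.maxIndex + ℓ →
    ∀ j : Fin n, j.val + 1 < μ.maxIndex → Expo.term K (Expo.move (maxGenDegree J) j μ) ∈ J

end QuasiStability

/-! The algorithm `DQS-Test`.  Its only input is a finite list of exponent vectors. -/

namespace DQS

variable {n : ℕ}

/-- `deg G`, the maximal degree of an element of `G`. -/
def degList (G : List (Expo n)) : ℕ := (G.map Expo.deg).foldr max 0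

/-- The test `x^ν ∈ ⟨G⟩`, carried out by searching for an element of `G` that divides `x^ν`. -/
def memTest (G : List (Expo n)) (ν : Expo n) : Bool :=
  G.any fun γ => decide (∀ i, γ i ≤ ν i)

theorem memTest_iff (K : Type*) [Field K] (G : List (Expo n)) (ν : Expo n) :
    memTest G ν = true ↔ Expo.term K ν ∈ termIdeal K {μ | μ ∈ G} := by
  have himg : Expo.term K '' {μ | μ ∈ G} = (fun s => MvPolynomial.monomial s (1 : K)) ''
      (Finsupp.equivFunOnFinite.symm '' {μ : Expo n | μ ∈ G}) := by
    rw [Set.image_image]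
    exact Set.image_congr fun μ _ => Expo.term_eq_monomial K μ
  classical
  rw [termIdeal, himg, MvPolynomial.mem_ideal_span_monomial_image, Expo.term_eq_monomial,
    MvPolynomial.support_monomial, if_neg one_ne_zero]
  simp only [memTest, List.any_eq_true, decide_eq_true_eq, Finset.mem_singleton, forall_eq,
    Set.exists_mem_image, Set.mem_ofPred_eq, Finsupp.le_def, Finsupp.equivFunOnFinite_symm_apply_apply]

theorem exists_purePowers (G : List (Expo n)) :
    ∃ j : ℕ, ∀ α : Fin n, α.val + 1 ≤ n - j → memTest G (Pi.single α (degList G)) = true :=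
  ⟨n, fun α h => by omega⟩

/-- The smallest `j` such that `x_α ^ deg G ∈ ⟨G⟩` for `α = 1, …, n - j`. -/
def ell (G : List (Expo n)) : ℕ := Nat.find (exists_purePowers G)

/-- `DQS-Test`: for all `x^μ` in `G` with `k = maxIndex μ ≥ n - ℓ` and for `i = 1, …, k - 1`, return
`false` if `x_i ^ deg G * x^μ / x_k ^ μ_k` is not in `⟨G⟩`; return `true` at the end. -/
def dqsTest (G : List (Expo n)) : Bool :=
  (G.filter fun μ => decide (n - ell G ≤ μ.maxIndex)).all fun μ =>
    ((List.finRange n).filter fun i => decide (i.val + 1 < μ.maxIndex)).all fun i =>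
      memTest G (Expo.move (degList G) i μ)

end DQS

/-! Checking quasi-stability on generators suffices, so the test decides `ℓ`-quasi-stability for `ℓ
= ell G`; it remains to compare `ℓ` with `D`. Always `D ≤ ℓ`: the first `n - ℓ` variables are
nilpotent modulo `J`. As the condition weakens when its parameter shrinks, `ℓ`-quasi-stable implies
`D`-quasi-stable. Conversely, let `J` be `D`-quasi-stable and `α ≤ n - D`. By dimension, `J`
contains a term in `x_α` and the last `D` variables; moving trailing variables to `x_α` yields a
power of `x_α` in `J`, so `ℓ ≤ D` (`IsMinimalBasis.ell_le`). -/

/-! ### Dimension bounds from coordinate subspaces. -/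

namespace MvPolynomial

variable {K σ : Type*} [Field K]

open Classical in
/-- The substitution that sets the variables outside `T` to zero. -/
noncomputable def restrictVars (K : Type*) [Field K] (T : Set σ) :
    MvPolynomial σ K →ₐ[K] MvPolynomial T K :=
  aeval fun i => if h : i ∈ T then X ⟨i, h⟩ else 0

theorem restrictVars_X_of_mem {T : Set σ} {i : σ} (h : i ∈ T) :
    restrictVars K T (X i) = X ⟨i, h⟩ := by
  simp [restrictVars, h]

theorem restrictVars_X_of_notMem {T : Set σ} {i : σ} (h : i ∉ T) :
    restrictVars K T (X i) = 0 := by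
  simp [restrictVars, h]

theorem restrictVars_surjective (T : Set σ) : Function.Surjective (restrictVars K T) := by
  intro f
  refine ⟨rename Subtype.val f, ?_⟩
  have h : (restrictVars K T).comp (rename Subtype.val) = AlgHom.id K _ := by
    ext i : 1
    simp [restrictVars_X_of_mem i.2]
  exact DFunLike.congr_fun h f

theorem ringKrullDim_eq_natCard [Finite σ] : ringKrullDim (MvPolynomial σ K) = Nat.card σ := by
  rw [ringKrullDim_of_isNoetherianRing, ringKrullDim_eq_zero_of_field, zero_add]

/-- An ideal that vanishes when the variables outside `T` are set to zero has a quotient of dimension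
at least `|T|`. -/
theorem natCard_le_ringKrullDim_quotient [Finite σ] (J : Ideal (MvPolynomial σ K)) (T : Set σ)
    (h : ∀ f ∈ J, restrictVars K T f = 0) :
    (Nat.card T : WithBot ℕ∞) ≤ ringKrullDim (MvPolynomial σ K ⧸ J) := by
  rw [← ringKrullDim_eq_natCard (K := K)]
  exact ringKrullDim_le_of_surjective (Ideal.Quotient.lift J (restrictVars K T).toRingHom h)
    (Ideal.Quotient.lift_surjective_of_surjective J h (restrictVars_surjective T))

/-- If every variable outside `T` is nilpotent modulo `J`, then `J` has a quotient of dimension at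
most `|T|`. -/
theorem ringKrullDim_quotient_le_natCard [Finite σ] (J : Ideal (MvPolynomial σ K)) (T : Set σ)
    (h : ∀ i ∉ T, (X i : MvPolynomial σ K) ∈ J.radical) :
    ringKrullDim (MvPolynomial σ K ⧸ J) ≤ Nat.card T := by
  -- Passing to the radical keeps the dimension and turns the nilpotent variables into zero.
  rw [ringKrullDim_quotient, ← PrimeSpectrum.zeroLocus_radical, ← ringKrullDim_quotient,
    ← ringKrullDim_eq_natCard (K := K)]
  let ψ : MvPolynomial T K →ₐ[K] MvPolynomial σ K ⧸ J.radical :=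
    (Ideal.Quotient.mkₐ K J.radical).comp (rename Subtype.val)
  refine ringKrullDim_le_of_surjective ψ.toRingHom fun y => ?_
  obtain ⟨f, rfl⟩ := Ideal.Quotient.mk_surjective y
  refine ⟨restrictVars K T f, ?_⟩
  have hψ : ψ.comp (restrictVars K T) = Ideal.Quotient.mkₐ K J.radical := by
    ext i : 1
    by_cases hi : i ∈ T
    · simp [ψ, restrictVars_X_of_mem hi]
    · simpa [ψ, restrictVars_X_of_notMem hi] using
        (Ideal.Quotient.eq_zero_iff_mem.2 (h i hi)).symm
  exact DFunLike.congr_fun hψ f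

end MvPolynomial

/-! ### Combinatorics of exponent vectors. -/

namespace Expo

variable {n : ℕ}

theorem term_dvd_term (K : Type*) [Field K] {μ ν : Expo n} (h : μ ≤ ν) : term K μ ∣ term K ν :=
  Finset.prod_dvd_prod_of_dvd _ _ fun i _ => pow_dvd_pow _ (h i)

theorem term_single (K : Type*) [Field K] (i : Fin n) (e : ℕ) :
    term K (Pi.single i e) = MvPolynomial.X i ^ e := by
  rw [term, Finset.prod_eq_single i (fun j _ hj => by simp [hj]) (by simp)]
  simp

theorem le_deg (μ : Expo n) (i : Fin n) : μ i ≤ deg μ :=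
  Finset.single_le_sum (f := μ) (fun _ _ => Nat.zero_le _) (Finset.mem_univ i)

theorem eq_single_of_le_single {μ : Expo n} {i : Fin n} {e : ℕ} (h : μ ≤ Pi.single i e) :
    μ = Pi.single i (μ i) := by
  ext k
  by_cases hk : k = i
  · subst hk; simp
  · have := h k
    simp only [Pi.single_apply, hk, if_false] at this ⊢
    omega

theorem lt_maxIndex {μ : Expo n} {i : Fin n} (h : μ i ≠ 0) : i.val < μ.maxIndex := by
  have h0 : μ ≠ 0 := fun h' => h (by simp [h'])
  rw [maxIndex, if_neg h0]
  have := Finset.le_sup (f := fun i : Fin n => if μ i = 0 then 0 else i.val + 1)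
    (Finset.mem_univ i)
  simp only [h, if_false] at this
  omega

theorem exists_maxIndex_eq {μ : Expo n} (h : μ ≠ 0) : ∃ i : Fin n, μ i ≠ 0 ∧
    μ.maxIndex = i.val + 1 := by
  obtain ⟨k, hk⟩ : ∃ k, μ k ≠ 0 := by
    by_contra! h'
    exact h (funext h')
  obtain ⟨i, -, hi⟩ := Finset.exists_mem_eq_sup Finset.univ ⟨k, Finset.mem_univ k⟩
    fun i : Fin n => if μ i = 0 then 0 else i.val + 1
  have hm : μ.maxIndex = if μ i = 0 then 0 else i.val + 1 := by
    rw [maxIndex, if_neg h]; exact hi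
  have hpos := lt_maxIndex hk
  by_cases h0 : μ i = 0
  · simp only [h0, if_true] at hm; omega
  · exact ⟨i, h0, by simpa [h0] using hm⟩

theorem maxIndex_mono {μ ν : Expo n} (hμ : μ ≠ 0) (h : μ ≤ ν) : μ.maxIndex ≤ ν.maxIndex := by
  obtain ⟨i, hi, hm⟩ := exists_maxIndex_eq hμ
  have := lt_maxIndex (μ := ν) (i := i) (by have : μ i ≤ ν i := h i; omega)
  omega

theorem move_mono {μ ν : Expo n} (q : ℕ) (j : Fin n) (h : μ ≤ ν)
    (hm : μ.maxIndex = ν.maxIndex) : move q j μ ≤ move q j ν := by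
  intro i
  have : μ i ≤ ν i := h i
  simp only [move, hm]
  split_ifs <;> omega

/-- The only variable erased from `ν` lies beyond the support of `μ`. -/
theorem le_move_of_maxIndex_lt {μ ν : Expo n} (q : ℕ) (j : Fin n) (h : μ ≤ ν)
    (hm : μ.maxIndex < ν.maxIndex) : μ ≤ move q j ν := by
  intro i
  have : μ i ≤ ν i := h i
  simp only [move]
  by_cases h0 : μ i = 0
  · omega
  · have := lt_maxIndex h0
    rw [if_neg (by omega)]
    omega

/-- Termination measure for the reduction to a pure power. -/
theorem maxIndex_move_lt {μ : Expo n} {q : ℕ} {j : Fin n} (hj : j.val + 1 < μ.maxIndex)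
    (h : move q j μ ≠ 0) : (move q j μ).maxIndex < μ.maxIndex := by
  obtain ⟨i, hi, hm⟩ := exists_maxIndex_eq h
  rw [hm]
  by_cases hij : i = j
  · subst hij; exact hj
  · simp only [move, hij, if_false, add_zero, ne_eq, ite_eq_left_iff, not_forall] at hi
    obtain ⟨h1, h2⟩ := hi
    have := lt_maxIndex h2
    omega

end Expo

/-! ### Minimal bases and reduction to generators. -/

section QuasiStability

variable {K : Type*} [Field K] {n : ℕ}

theorem term_mem_of_le {J : Ideal (MvPolynomial (Fin n) K)} {μ ν : Expo n} (h : μ ≤ ν)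
    (hμ : Expo.term K μ ∈ J) : Expo.term K ν ∈ J :=
  J.mem_of_dvd (Expo.term_dvd_term K h) hμ

theorem IsMinimalBasis.term_mem_iff {J : Ideal (MvPolynomial (Fin n) K)} {G : List (Expo n)}
    (hG : IsMinimalBasis {μ | μ ∈ G} J) (ν : Expo n) :
    Expo.term K ν ∈ J ↔ ∃ γ ∈ G, γ ≤ ν := by
  rw [← hG.1, ← DQS.memTest_iff]
  simp [DQS.memTest, Pi.le_def]

theorem IsMinimalBasis.memTest_iff_mem {J : Ideal (MvPolynomial (Fin n) K)} {G : List (Expo n)}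
    (hG : IsMinimalBasis {μ | μ ∈ G} J) (ν : Expo n) :
    DQS.memTest G ν = true ↔ Expo.term K ν ∈ J := by
  rw [DQS.memTest_iff K, hG.1]

theorem IsMinimalBasis.minimalGenerators_eq {J : Ideal (MvPolynomial (Fin n) K)}
    {G : List (Expo n)} (hG : IsMinimalBasis {μ | μ ∈ G} J) :
    minimalGenerators J = {μ | μ ∈ G} := by
  ext μ
  constructor
  · intro hμ
    obtain ⟨γ, hγ, hle⟩ := (hG.term_mem_iff μ).1 hμ.1
    have := hμ.2 ((hG.term_mem_iff γ).2 ⟨γ, hγ, le_rfl⟩) hle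
    rwa [le_antisymm this hle]
  · intro hμ
    refine ⟨(hG.term_mem_iff μ).2 ⟨μ, hμ, le_rfl⟩, fun ν hν hle => ?_⟩
    obtain ⟨γ, hγ, hγν⟩ := (hG.term_mem_iff ν).1 hν
    by_cases hne : γ = μ
    · exact hne ▸ hγν
    exfalso
    -- Here `γ ≤ ν ≤ μ` and `γ ≠ μ`, so `μ` is redundant in the basis.
    have hμG : {ν | ν ∈ G} \ {μ} ⊂ {ν | ν ∈ G} :=
      ⟨Set.sdiff_subset, fun hs => (hs hμ).2 rfl⟩
    refine hG.2 _ hμG (le_antisymm ?_ ?_)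
    · rw [← hG.1]
      exact Ideal.span_mono (Set.image_mono Set.sdiff_subset)
    · rw [← hG.1, termIdeal, Ideal.span_le]
      rintro _ ⟨δ, hδ, rfl⟩
      by_cases hδμ : δ = μ
      · subst hδμ
        exact term_mem_of_le (hγν.trans hle)
          (Ideal.subset_span (Set.mem_image_of_mem _ ⟨hγ, hne⟩))
      · exact Ideal.subset_span (Set.mem_image_of_mem _ ⟨hδ, hδμ⟩)

theorem deg_le_degList {G : List (Expo n)} {μ : Expo n} (h : μ ∈ G) :
    μ.deg ≤ DQS.degList G := by
  induction G with
  | nil => simp at h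
  | cons γ G ih =>
    simp only [DQS.degList, List.map_cons, List.foldr_cons] at ih ⊢
    rcases List.mem_cons.1 h with rfl | h
    · exact le_max_left _ _
    · exact (ih h).trans (le_max_right _ _)

theorem degList_le {G : List (Expo n)} {d : ℕ} (h : ∀ μ ∈ G, μ.deg ≤ d) :
    DQS.degList G ≤ d := by
  induction G with
  | nil => simp [DQS.degList]
  | cons γ G ih =>
    simp only [DQS.degList, List.map_cons, List.foldr_cons] at ih ⊢
    exact max_le (h γ (by simp)) (ih fun μ hμ => h μ (by simp [hμ]))

theorem IsMinimalBasis.maxGenDegree_eq {J : Ideal (MvPolynomial (Fin n) K)}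
    {G : List (Expo n)} (hG : IsMinimalBasis {μ | μ ∈ G} J) :
    maxGenDegree J = DQS.degList G := by
  have hmem : ∀ μ, μ ∈ (minimalGenerators_finite J).toFinset ↔ μ ∈ G := fun μ => by
    rw [Set.Finite.mem_toFinset, hG.minimalGenerators_eq]; rfl
  apply le_antisymm
  · exact Finset.sup_le fun μ hμ => deg_le_degList ((hmem μ).1 hμ)
  · exact degList_le fun μ hμ => Finset.le_sup (f := Expo.deg) ((hmem μ).2 hμ)

/-- A pure power in a monomial ideal can be lowered to the maximal degree of a generator. -/
theorem IsMinimalBasis.pure_power_mem {J : Ideal (MvPolynomial (Fin n) K)}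
    {G : List (Expo n)} (hG : IsMinimalBasis {μ | μ ∈ G} J) {α : Fin n} {e : ℕ}
    (h : Expo.term K (Pi.single α e) ∈ J) :
    Expo.term K (Pi.single α (DQS.degList G)) ∈ J := by
  obtain ⟨γ, hγ, hle⟩ := (hG.term_mem_iff _).1 h
  refine (hG.term_mem_iff _).2 ⟨γ, hγ, ?_⟩
  -- A divisor of a pure power is a pure power of the same variable.
  rw [Expo.eq_single_of_le_single hle]
  exact Pi.single_mono _ ((γ.le_deg α).trans (deg_le_degList hγ))

/-- It suffices to test quasi-stability on the minimal basis. -/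
theorem IsMinimalBasis.isQuasiStable_iff {J : Ideal (MvPolynomial (Fin n) K)}
    {G : List (Expo n)} (hG : IsMinimalBasis {μ | μ ∈ G} J) (hJ : J ≠ ⊤) (ℓ : ℕ) :
    IsQuasiStable ℓ J ↔ ∀ μ ∈ G, n ≤ μ.maxIndex + ℓ → ∀ j : Fin n, j.val + 1 < μ.maxIndex →
      Expo.term K (Expo.move (DQS.degList G) j μ) ∈ J := by
  rw [IsQuasiStable, hG.maxGenDegree_eq]
  constructor
  · exact fun h μ hμ => h μ ((hG.term_mem_iff μ).2 ⟨μ, hμ, le_rfl⟩)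
  · intro h μ hμ hn j hj
    obtain ⟨γ, hγ, hle⟩ := (hG.term_mem_iff μ).1 hμ
    have hγJ : Expo.term K γ ∈ J := (hG.term_mem_iff γ).2 ⟨γ, hγ, le_rfl⟩
    have hγ0 : γ ≠ 0 := by
      rintro rfl
      exact hJ ((Ideal.eq_top_iff_one J).2 (by simpa [Expo.term] using hγJ))
    -- Either the move leaves the divisor `γ` intact, or it acts on the same last variable of `γ`
    -- and `μ`.
    rcases (Expo.maxIndex_mono hγ0 hle).lt_or_eq with hlt | heq
    · exact term_mem_of_le (Expo.le_move_of_maxIndex_lt _ j hle hlt) hγJ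
    · exact term_mem_of_le (Expo.move_mono _ j hle heq)
        (h γ hγ (heq ▸ hn) j (heq ▸ hj))

theorem IsMinimalBasis.dqsTest_iff {J : Ideal (MvPolynomial (Fin n) K)}
    {G : List (Expo n)} (hG : IsMinimalBasis {μ | μ ∈ G} J) (hJ : J ≠ ⊤) :
    DQS.dqsTest G = true ↔ IsQuasiStable (DQS.ell G) J := by
  rw [hG.isQuasiStable_iff hJ]
  simp only [DQS.dqsTest, List.all_eq_true, List.mem_filter, List.mem_finRange, true_and,
    decide_eq_true_eq, hG.memTest_iff_mem, and_imp, Nat.sub_le_iff_le_add]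

theorem IsQuasiStable.anti {J : Ideal (MvPolynomial (Fin n) K)} {ℓ ℓ' : ℕ}
    (h : IsQuasiStable ℓ J) (hle : ℓ' ≤ ℓ) : IsQuasiStable ℓ' J :=
  fun μ hμ hn => h μ hμ (by omega)

/-! ### Comparison of `ell G` with the dimension. -/

theorem natCard_setOf_sub_le {d : ℕ} (hd : d ≤ n) :
    Nat.card {i : Fin n | n - d ≤ i.val} = d := by
  have h : {i : Fin n | n - d ≤ i.val} ≃ Fin d :=
    { toFun := fun i => ⟨i.1.val - (n - d), by have := i.2; have := i.1.isLt; grind⟩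
      invFun := fun k => ⟨⟨k.val + (n - d), by omega⟩, by simp; omega⟩
      left_inv := fun i => by
        have : n - d ≤ i.1.val := i.2
        ext; simp only; omega
      right_inv := fun k => by ext; simp }
  rw [Nat.card_congr h, Nat.card_fin]

theorem IsMinimalBasis.ringKrullDim_le_ell {J : Ideal (MvPolynomial (Fin n) K)}
    {G : List (Expo n)} (hG : IsMinimalBasis {μ | μ ∈ G} J) :
    ringKrullDim (MvPolynomial (Fin n) K ⧸ J) ≤ DQS.ell G := by
  -- For `j = n` the condition defining `ell` is void.
  have hn : DQS.ell G ≤ n := Nat.find_le fun α h => by omega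
  have hℓ : ∀ α : Fin n, α.val + 1 ≤ n - DQS.ell G →
      DQS.memTest G (Pi.single α (DQS.degList G)) = true := Nat.find_spec (DQS.exists_purePowers G)
  have h := MvPolynomial.ringKrullDim_quotient_le_natCard J
    {i : Fin n | n - DQS.ell G ≤ i.val} fun i hi => by
      refine ⟨DQS.degList G, ?_⟩
      rw [← Expo.term_single, ← hG.memTest_iff_mem]
      refine hℓ i ?_
      have : ¬ n - DQS.ell G ≤ i.val := hi
      omega
  rwa [natCard_setOf_sub_le hn] at h

/-- A set of more than `dim (P / J)` variables supports a term of the monomial ideal `J`. -/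
theorem exists_term_mem_of_ringKrullDim_lt {J : Ideal (MvPolynomial (Fin n) K)}
    {G : List (Expo n)} (hG : IsMinimalBasis {μ | μ ∈ G} J) (T : Set (Fin n))
    (hT : ringKrullDim (MvPolynomial (Fin n) K ⧸ J) < Nat.card T) :
    ∃ μ : Expo n, Expo.term K μ ∈ J ∧ ∀ i ∉ T, μ i = 0 := by
  by_contra! hcon
  refine absurd (MvPolynomial.natCard_le_ringKrullDim_quotient J T ?_) (not_le.2 hT)
  -- Otherwise each generator involves a variable outside `T` and is killed by the restriction.
  suffices J ≤ RingHom.ker (MvPolynomial.restrictVars K T) from fun f hf => this hf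
  rw [← hG.1, termIdeal, Ideal.span_le]
  rintro _ ⟨γ, hγ, rfl⟩
  obtain ⟨i, hi, h0⟩ := hcon γ ((hG.term_mem_iff γ).2 ⟨γ, hγ, le_rfl⟩)
  simp only [SetLike.mem_coe, RingHom.mem_ker, Expo.term, map_prod, map_pow]
  exact Finset.prod_eq_zero (Finset.mem_univ i)
    (by rw [MvPolynomial.restrictVars_X_of_notMem hi, zero_pow h0])

/-- Quasi-stability reduces a term supported on `x_α` and the last `D` variables to a pure power. -/
theorem IsQuasiStable.exists_pure_power_mem {J : Ideal (MvPolynomial (Fin n) K)} {D : ℕ}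
    (hJ : IsQuasiStable D J) {α : Fin n} (hα : α.val + 1 ≤ n - D) (μ : Expo n)
    (hμ : Expo.term K μ ∈ J) (hsupp : ∀ i, i ≠ α → i.val < n - D → μ i = 0) :
    ∃ e, Expo.term K (Pi.single α e) ∈ J := by
  induction hm : μ.maxIndex using Nat.strong_induction_on generalizing μ with
  | _ m ih =>
    subst hm
    by_cases hpure : ∀ i, i ≠ α → μ i = 0
    · refine ⟨μ α, term_mem_of_le (fun i => ?_) hμ⟩
      by_cases hi : i = α
      · subst hi; simp
      · simp [hpure i hi]
    · push Not at hpure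
      obtain ⟨i, hiα, hi⟩ := hpure
      have hlt := Expo.lt_maxIndex hi
      have hge : n - D ≤ i.val := by
        by_contra hlt'
        exact hi (hsupp i hiα (by omega))
      have hmem := hJ μ hμ (by omega) α (by omega)
      -- If the move yields the term 1, exponent 0 already works.
      by_cases h0 : Expo.move (maxGenDegree J) α μ = 0
      · exact ⟨0, by simpa [h0] using hmem⟩
      · refine ih _ (Expo.maxIndex_move_lt (by omega) h0) _ hmem (fun k hk hkD => ?_) rfl
        simp [Expo.move, hk, hsupp k hk hkD]

theorem IsMinimalBasis.ell_le {J : Ideal (MvPolynomial (Fin n) K)}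
    {G : List (Expo n)} (hG : IsMinimalBasis {μ | μ ∈ G} J) {D : ℕ}
    (hD : ringKrullDim (MvPolynomial (Fin n) K ⧸ J) = D) (hJ : IsQuasiStable D J) :
    DQS.ell G ≤ D := by
  refine Nat.find_min' _ fun α hα => ?_
  rw [hG.memTest_iff_mem]
  -- One variable more than the dimension; `hα` gives both `D < n` and that `α` is not among the
  -- last `D`.
  have hcard : Nat.card (insert α {i : Fin n | n - D ≤ i.val} : Set (Fin n)) = D + 1 := by
    rw [Nat.card_coe_set_eq, Set.ncard_insert_of_notMem (by simp; omega),
      ← Nat.card_coe_set_eq, natCard_setOf_sub_le (by omega)]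
  obtain ⟨μ, hμ, hsupp⟩ := exists_term_mem_of_ringKrullDim_lt hG
    (insert α {i : Fin n | n - D ≤ i.val}) (by
      rw [hD, hcard]; exact_mod_cast Nat.lt_succ_self D)
  obtain ⟨e, he⟩ := hJ.exists_pure_power_mem hα μ hμ fun i hi hiD => hsupp i (by
    simp only [Set.mem_insert_iff, hi, Set.mem_ofPred_eq, false_or]; omega)
  exact hG.pure_power_mem he

end QuasiStability

theorem mainTheorem10 {K : Type*} [Field K] {n : ℕ}
    (J : Ideal (MvPolynomial (Fin n) K)) (G : List (Expo n))
    (hG : IsMinimalBasis {μ | μ ∈ G} J)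
    (D : ℕ) (hD : ringKrullDim (MvPolynomial (Fin n) K ⧸ J) = D) :
    DQS.dqsTest G = true ↔ IsQuasiStable D J := by
  -- The zero ring has dimension `⊥`, so a natural number `D` forces `J` to be proper.
  have hJ : J ≠ ⊤ := by
    rintro rfl
    rw [ringKrullDim_eq_bot_of_subsingleton] at hD
    exact absurd hD WithBot.bot_ne_coe
  rw [hG.dqsTest_iff hJ]
  have hle : D ≤ DQS.ell G := by
    have := hG.ringKrullDim_le_ell
    rw [hD] at this
    exact_mod_cast this
  exact ⟨fun h => h.anti hle, fun h => h.anti (hG.ell_le hD h)⟩
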